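/- Let $N,W,L$ be positive integers with $W\le N$. Put $\alpha=\gcd(L,N)$ and $R=N/\alpha$, and assume $R\ge 3$ and $W\ge \alpha+2$. For $x\in\mathbb C^N$, with indices read modulo $N$, for $w\in\mathbb C^W$ and $k\in\mathbb Z$, let $$y_k(x,w)=\bigl(x[k]w[0],\,x[k-1]w[1],\,\dots,\,x[k-(W-1)]w[W-1]\bigr)\in\mathbb C^W .$$ Let $Z\subset(\mathbb C^W)^3$ be the closure of the image of the map $\mathbb C^N\times\mathbb C^W\to(\mathbb C^W)^3$, $(x,w)\mapsto (y_0,y_\alpha,y_{-\alpha})$. For $y\in\mathbb C^W$ let $A_y(\omega)=\bigl|\sum_{n=0}^{W-1}y[n]\omega^n\bigr|^2$, $\omega\in S^1$, be its Fourier intensity function. Then for generic $(z_0,z_\alpha,z_{-\alpha})\in Z$ the following holds: if $(z'_0,z'_\alpha,z'_{-\alpha})\in Z$ satisfies $A_{z'_j}=A_{z_j}$ on $S^1$ for $j=0,\alpha,-\alpha$, then there are angles $\theta_0,\theta_\alpha\in\mathbb R$ such that $$z'_0=e^{i\theta_0}z_0,\qquad z'_\alpha=e^{i(\theta_0+\theta_\alpha)}z_\alpha,\qquad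 z'_{-\alpha}=e^{i(\theta_0-\theta_\alpha)}z_{-\alpha}.$$ Here "generic" means: there is a polynomial with real coefficients in the real and imaginary parts of the $3W$ coordinates that does not vanish identically on $Z$, such that the assertion holds for every point of $Z$ at which the polynomial is non-zero. -/

import Mathlib

noncomputable section

namespace BlindSTFT

/-- The windowed section `y_k(x, w) = (x[k] w[0], x[k-1] w[1], …, x[k-(W-1)] w[W-1])` of an
`N`-periodic signal `x`; indices of `x` are taken modulo `N`. -/
def windowedSection {N W : ℕ} (x : ZMod N → ℂ) (w : Fin W → ℂ) (k : ℤ) : Fin W → ℂ :=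
  fun n => x (((k - (n : ℕ) : ℤ)) : ZMod N) * w n

/-- The map `(x, w) ↦ (y_0, y_α, y_{-α})`. A triple `z` of vectors of `ℂ^W` is stored as a function
on `Fin 3`, with `z 0 = z_0`, `z 1 = z_α` and `z 2 = z_{-α}`. -/
def tripleMap (N W α : ℕ) (p : (ZMod N → ℂ) × (Fin W → ℂ)) : Fin 3 → Fin W → ℂ :=
  ![windowedSection p.1 p.2 0, windowedSection p.1 p.2 (α : ℤ),
    windowedSection p.1 p.2 (-(α : ℤ))]

/-- The set `Z ⊆ (ℂ^W)^3`: the closure of the image of `(x, w) ↦ (y_0, y_α, y_{-α})`. (The image of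
a complex polynomial map is constructible, so its Zariski and Euclidean closures coincide.) -/
def tripleVariety (N W α : ℕ) : Set (Fin 3 → Fin W → ℂ) :=
  closure (Set.range (tripleMap N W α))

/-- The Fourier intensity function `A_y(ω) = |y[0] + y[1] ω + … + y[W-1] ω^(W-1)|²` on the unit
circle. -/
def fourierIntensity {W : ℕ} (y : Fin W → ℂ) (ω : Circle) : ℝ :=
  ‖∑ n : Fin W, y n * (ω : ℂ) ^ (n : ℕ)‖ ^ 2

/-- The value at `z` of a real polynomial in the real parts (`Sum.inl`) and the imaginary parts
(`Sum.inr`) of the entries of the triple `z`. -/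
def evalReIm {W : ℕ} (q : MvPolynomial ((Fin 3 × Fin W) ⊕ (Fin 3 × Fin W)) ℝ)
    (z : Fin 3 → Fin W → ℂ) : ℝ :=
  MvPolynomial.eval
    (Sum.elim (fun i => (z i.1 i.2).re) (fun i => (z i.1 i.2).im)) q

/-- `P` holds for generic `z ∈ Z`, for an irreducible `Z`: the points of `Z` where `P` fails lie in
the zero set of a real polynomial that does not vanish identically on `Z`. -/
def HoldsGenerically {W : ℕ} (Z : Set (Fin 3 → Fin W → ℂ))
    (P : (Fin 3 → Fin W → ℂ) → Prop) : Prop :=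
  ∃ q : MvPolynomial ((Fin 3 × Fin W) ⊕ (Fin 3 × Fin W)) ℝ,
    (∃ z ∈ Z, evalReIm q z ≠ 0) ∧ ∀ z ∈ Z, evalReIm q z ≠ 0 → P z

end BlindSTFT

end

/-! Write `d = W - 1` and identify a vector with the polynomial it is the coefficient list of. The
Fourier intensity determines the product of this polynomial with its conjugate reversal. Hence a
vector with the same intensity as `y` is, up to a scalar, the product of `l` root factors of `y` and
`d - l` root factors of the conjugate reversal of `y` (`exists_root_selection`). On the other hand,
points of `Z` satisfy `z 0 n * z 0 (α + n) = z 2 n * z 1 (α + n)` (`binomialRelations_of_mem`).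
Dividing two consecutive relations removes the unknown scalars and leaves `crossRelation`.

For each choice of counts `l` other than `(d, d, d)`, an exchange of that type generically violates
a cross relation (`exists_exchange`). The violation is a polynomial condition on ordered roots;
symmetrizing over orderings (`exists_elimination`) and clearing denominators turns it into a
polynomial in `z` and `conj z`. To see that it is not identically zero, `z` and `conj z` may be
treated as independent points of the image, since the pairs `(u, conj u)` are Zariski dense
(`exists_eval_conj_ne_zero`). One may then give `z j` the polynomial `(X + ε) ^ d` and the reversed
formal conjugate `(X + η j) ^ d`, and compare orders, degrees and trailing coefficients in `ε`.

There are finitely many `l`, so one polynomial excludes them all. What remains is `z' j = a j • z j`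
with `‖a j‖ = 1`, and one binomial relation gives `a 0 ^ 2 = a 2 * a 1`. -/

namespace BlindSTFT

/-! ### Eliminating the ordering of the roots -/

/-- The coefficients, below the leading one, of the monic polynomial with roots `r`. -/
noncomputable def rootCoeff {d : ℕ} (r : Fin d → ℂ) : Fin d → ℂ := fun n =>
  (∏ i, (Polynomial.X - Polynomial.C (r i))).coeff n

lemma eval_esymm_eq_rootCoeff {d : ℕ} (r : Fin d → ℂ) (n : Fin d) :
    (Finset.univ.val.map r).esymm (n + 1) =
      (-1) ^ (n + 1 : ℕ) * rootCoeff r n.rev := by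
  have h := Multiset.prod_X_sub_C_coeff (Finset.univ.val.map r) (k := (n.rev : ℕ)) (by simp)
  have h2 : (Multiset.map (fun t => Polynomial.X - Polynomial.C t)
      (Finset.univ.val.map r)).prod = ∏ i, (Polynomial.X - Polynomial.C (r i)) := by
    rw [Multiset.map_map]; rfl
  rw [h2] at h
  have h3 : d - (n.rev : ℕ) = n + 1 := by rw [Fin.val_rev]; omega
  simp only [Multiset.card_map, Finset.card_val, Finset.card_univ, Fintype.card_fin, h3] at h
  rw [rootCoeff, h, ← mul_assoc, ← mul_pow]
  simp

/-- The product over all reorderings is symmetric, so the fundamental theorem of symmetric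
polynomials applies. A general coefficient ring `T`, with `G` independent of `θ`, lets the other
blocks of roots serve as parameters. -/
lemma exists_symmetrization {d : ℕ} {T : Type*} [CommRing T] (P : MvPolynomial (Fin d) T) :
    ∃ G : MvPolynomial (Fin d) T, ∀ (θ : T →+* ℂ) (r : Fin d → ℂ),
      MvPolynomial.eval₂ θ (rootCoeff r) G =
        ∏ π : Equiv.Perm (Fin d), MvPolynomial.eval₂ θ (r ∘ π) P := by
  set S : MvPolynomial (Fin d) T := ∏ π : Equiv.Perm (Fin d), MvPolynomial.rename π P with hS
  have hsym : S.IsSymmetric := by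
    intro e
    rw [hS, map_prod]
    refine Fintype.prod_equiv (Equiv.mulLeft e) _ _ fun π => ?_
    rw [MvPolynomial.rename_rename]; rfl
  obtain ⟨G, hG⟩ := MvPolynomial.esymmAlgHom_surjective (σ := Fin d) (R := T) (n := d)
    (by simp) ⟨S, hsym⟩
  have hG' : MvPolynomial.aeval (fun i : Fin d => MvPolynomial.esymm (Fin d) T (i + 1)) G = S := by
    rw [← MvPolynomial.esymmAlgHom_apply, hG]
  refine ⟨MvPolynomial.aeval (fun i : Fin d =>
    MvPolynomial.C ((-1) ^ (i + 1 : ℕ)) * MvPolynomial.X i.rev) G, fun θ r => ?_⟩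
  have h1 : MvPolynomial.eval₂ θ r S =
      ∏ π : Equiv.Perm (Fin d), MvPolynomial.eval₂ θ (r ∘ π) P := by
    rw [hS, ← MvPolynomial.coe_eval₂Hom, map_prod]
    refine Finset.prod_congr rfl fun π _ => ?_
    rw [MvPolynomial.coe_eval₂Hom, MvPolynomial.eval₂_rename]
  rw [← h1, ← hG', MvPolynomial.aeval_def, MvPolynomial.aeval_def,
    ← MvPolynomial.coe_eval₂Hom θ, ← MvPolynomial.coe_eval₂Hom θ,
    MvPolynomial.hom_eval₂, MvPolynomial.hom_eval₂]
  have h2 : ∀ g : Fin d → ℂ, (MvPolynomial.eval₂Hom θ g).comp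
      (algebraMap T (MvPolynomial (Fin d) T)) = θ := by
    intro g; ext t; simp [MvPolynomial.algebraMap_eq]
  rw [h2, h2]
  congr 1
  funext i
  have h3 : (MvPolynomial.eval₂Hom θ r) (MvPolynomial.esymm (Fin d) T (i + 1)) =
      (Finset.univ.val.map r).esymm (i + 1) := by
    rw [Finset.esymm_map_val, MvPolynomial.esymm, map_sum]
    simp
  rw [h3, eval_esymm_eq_rootCoeff]
  simp

lemma exists_elimination_step {κ : Type*} [DecidableEq κ] {d : ℕ}
    (P : MvPolynomial (κ × Fin d) ℂ) (f : κ) :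
    ∃ P' : MvPolynomial (κ × Fin d) ℂ, ∀ r : κ → Fin d → ℂ,
      MvPolynomial.eval (fun a => Function.update r f (rootCoeff (r f)) a.1 a.2) P' = 0 ↔
        ∃ π : Equiv.Perm (Fin d),
          MvPolynomial.eval (fun a => Function.update r f (r f ∘ π) a.1 a.2) P = 0 := by
  obtain ⟨G, hG⟩ := exists_symmetrization (d := d) (T := MvPolynomial (κ × Fin d) ℂ)
    (MvPolynomial.eval₂ (MvPolynomial.C.comp MvPolynomial.C)
      (fun a => if a.1 = f then MvPolynomial.X a.2 else MvPolynomial.C (MvPolynomial.X a)) P)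
  refine ⟨MvPolynomial.eval₂ (RingHom.id _) (fun i => MvPolynomial.X (f, i)) G, fun r => ?_⟩
  have h1 := hG (MvPolynomial.eval (fun a => Function.update r f (rootCoeff (r f)) a.1 a.2)) (r f)
  rw [MvPolynomial.hom_eval₂]
  have h2 : (fun i : Fin d => (MvPolynomial.eval fun a : κ × Fin d =>
      Function.update r f (rootCoeff (r f)) a.1 a.2) (MvPolynomial.X (f, i))) =
      rootCoeff (r f) := by
    funext i; simp
  rw [RingHom.comp_id, h2, h1, Finset.prod_eq_zero_iff]
  simp only [Finset.mem_univ, true_and]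
  refine exists_congr fun π => ?_
  rw [← MvPolynomial.coe_eval₂Hom, MvPolynomial.hom_eval₂]
  have h3 : (MvPolynomial.eval₂Hom (MvPolynomial.eval fun a : κ × Fin d =>
      Function.update r f (rootCoeff (r f)) a.1 a.2) (r f ∘ π)).comp
      (MvPolynomial.C.comp MvPolynomial.C) = RingHom.id ℂ := by
    ext; simp
  rw [h3, MvPolynomial.eval₂_id]
  have h4 : (fun a : κ × Fin d => (MvPolynomial.eval₂Hom (MvPolynomial.eval fun a : κ × Fin d =>
      Function.update r f (rootCoeff (r f)) a.1 a.2) (r f ∘ π))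
      (if a.1 = f then MvPolynomial.X a.2 else MvPolynomial.C (MvPolynomial.X a))) =
      fun a => Function.update r f (r f ∘ π) a.1 a.2 := by
    funext ⟨g, i⟩
    by_cases hg : g = f
    · subst hg; simp
    · simp [hg]
  rw [h4]

/-- The blocks are symmetrized one at a time; a product over permutations vanishes exactly when one
of its factors does, which produces the existential over `π`. -/
lemma exists_elimination {κ : Type*} [Fintype κ] [DecidableEq κ] {d : ℕ}
    (P : MvPolynomial (κ × Fin d) ℂ) :
    ∃ P' : MvPolynomial (κ × Fin d) ℂ, ∀ r : κ → Fin d → ℂ,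
      MvPolynomial.eval (fun a => rootCoeff (r a.1) a.2) P' = 0 ↔
        ∃ π : κ → Equiv.Perm (Fin d),
          MvPolynomial.eval (fun a => r a.1 (π a.1 a.2)) P = 0 := by
  suffices h : ∀ s : Finset κ, ∃ P' : MvPolynomial (κ × Fin d) ℂ, ∀ r : κ → Fin d → ℂ,
      MvPolynomial.eval (fun a => if a.1 ∈ s then rootCoeff (r a.1) a.2 else r a.1 a.2) P' = 0 ↔
        ∃ π : κ → Equiv.Perm (Fin d), (∀ f ∉ s, π f = 1) ∧
          MvPolynomial.eval (fun a => r a.1 (π a.1 a.2)) P = 0 by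
    simpa using h Finset.univ
  intro s
  induction s using Finset.induction_on with
  | empty =>
    refine ⟨P, fun r => ?_⟩
    constructor
    · intro h; exact ⟨fun _ => 1, by simp, by simpa using h⟩
    · rintro ⟨π, hπ, h⟩
      have : π = fun _ => 1 := funext fun f => hπ f (by simp)
      subst this; simpa using h
  | insert f s hf ih =>
    obtain ⟨P₁, h₁⟩ := ih
    obtain ⟨P₂, h₂⟩ := exists_elimination_step P₁ f
    refine ⟨P₂, fun r => ?_⟩
    have e1 : (fun a : κ × Fin d => if a.1 ∈ insert f s then rootCoeff (r a.1) a.2 else r a.1 a.2)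
        = fun a => Function.update (fun g => if g ∈ s then rootCoeff (r g) else r g) f
          (rootCoeff (r f)) a.1 a.2 := by
      funext ⟨g, i⟩
      by_cases hg : g = f
      · subst hg; simp
      · simp only [Finset.mem_insert, hg, false_or, ne_eq, not_false_eq_true,
          Function.update_of_ne]
        split_ifs <;> rfl
    have e2 := h₂ (fun g => if g ∈ s then rootCoeff (r g) else r g)
    simp only [hf, if_false] at e2
    rw [e1, e2]
    have e3 : ∀ π : Equiv.Perm (Fin d), (fun a : κ × Fin d => Function.update
        (fun g => if g ∈ s then rootCoeff (r g) else r g) f (r f ∘ π) a.1 a.2) =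
        fun a => if a.1 ∈ s then rootCoeff (Function.update r f (r f ∘ π) a.1) a.2
          else Function.update r f (r f ∘ π) a.1 a.2 := by
      intro π
      funext ⟨g, i⟩
      by_cases hg : g = f
      · subst hg; simp [hf]
      · simp only [hg, ne_eq, not_false_eq_true, Function.update_of_ne]
        split_ifs <;> rfl
    simp only [e3, h₁]
    constructor
    · rintro ⟨π, ρ, hρ, h⟩
      refine ⟨Function.update ρ f π, ?_, ?_⟩
      · intro g hg
        simp only [Finset.mem_insert, not_or] at hg
        rw [Function.update_of_ne hg.1]; exact hρ g hg.2
      · convert h using 3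
        funext ⟨g, i⟩
        by_cases hg : g = f
        · subst hg; simp [hρ g hf]
        · simp [hg]
    · rintro ⟨ρ, hρ, h⟩
      refine ⟨ρ f, Function.update ρ f 1, ?_, ?_⟩
      · intro g hg
        by_cases hgf : g = f
        · subst hgf; simp
        · rw [Function.update_of_ne hgf]
          exact hρ g (by simp [hgf, hg])
      · convert h using 3
        funext ⟨g, i⟩
        by_cases hg : g = f
        · subst hg; simp
        · simp [hg]

/-! ### Denominators, formal conjugates and real polynomials -/

/-- Clearing denominators: a polynomial in the fractions `m t / e t` becomes polynomial after
multiplication by a power of a common multiple `u` of the denominators. -/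
lemma exists_clear_denominators {σ τ : Type*} (u : MvPolynomial σ ℂ)
    (m e : τ → MvPolynomial σ ℂ) (he : ∀ t, e t ∣ u) (p : MvPolynomial τ ℂ) :
    ∃ (D : ℕ) (Q : MvPolynomial σ ℂ), ∀ v : σ → ℂ, MvPolynomial.eval v u ≠ 0 →
      MvPolynomial.eval v Q = MvPolynomial.eval v u ^ D *
        MvPolynomial.eval (fun t => MvPolynomial.eval v (m t) / MvPolynomial.eval v (e t)) p := by
  induction p using MvPolynomial.induction_on with
  | C a => exact ⟨0, MvPolynomial.C a, by simp⟩
  | add p q hp hq =>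
    obtain ⟨D, Q, h⟩ := hp
    obtain ⟨D', Q', h'⟩ := hq
    refine ⟨D + D', u ^ D' * Q + u ^ D * Q', fun v hv => ?_⟩
    simp only [map_add, map_mul, map_pow, h v hv, h' v hv]
    ring
  | mul_X p t hp =>
    obtain ⟨D, Q, h⟩ := hp
    obtain ⟨c, hc⟩ := he t
    refine ⟨D + 1, Q * m t * c, fun v hv => ?_⟩
    have hu : MvPolynomial.eval v u = MvPolynomial.eval v (e t) * MvPolynomial.eval v c := by
      rw [hc, map_mul]
    have het : MvPolynomial.eval v (e t) ≠ 0 := fun h0 => hv (by rw [hu, h0, zero_mul])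
    simp only [map_mul, h v hv, MvPolynomial.eval_X, pow_succ]
    nth_rewrite 3 [hu]
    field_simp

/-- A complex polynomial in variables and conjugate variables that vanishes on all pairs
`(u, conj u)` is zero. -/
lemma exists_eval_conj_ne_zero {τ : Type*} {P : MvPolynomial (τ ⊕ τ) ℂ} (hP : P ≠ 0) :
    ∃ u : τ → ℂ, MvPolynomial.eval (Sum.elim u (fun t => star (u t))) P ≠ 0 := by
  by_contra! h
  apply hP
  -- The invertible substitution `a + I b`, `a - I b` turns pairs `(u, conj u)` into real points,
  -- and a polynomial vanishing at all real points is zero.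
  set P₁ : MvPolynomial (τ ⊕ τ) ℂ := MvPolynomial.bind₁ (Sum.elim
    (fun t => MvPolynomial.X (Sum.inl t) + MvPolynomial.C Complex.I * MvPolynomial.X (Sum.inr t))
    (fun t => MvPolynomial.X (Sum.inl t) - MvPolynomial.C Complex.I * MvPolynomial.X (Sum.inr t)))
    P with hP₁
  have e : ∀ v : τ ⊕ τ → ℂ, MvPolynomial.eval v P₁ = MvPolynomial.eval (Sum.elim
      (fun t => v (Sum.inl t) + Complex.I * v (Sum.inr t))
      (fun t => v (Sum.inl t) - Complex.I * v (Sum.inr t))) P := by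
    intro v
    rw [hP₁, MvPolynomial.eval, MvPolynomial.eval₂Hom_bind₁]
    congr 2
    funext t
    rcases t with t | t <;> simp
  have h0 : P₁ = 0 := by
    refine MvPolynomial.funext_set (fun _ => Set.range ((↑) : ℝ → ℂ))
      (fun _ => Set.infinite_range_of_injective Complex.ofReal_injective) ?_
    intro v hv
    choose a ha using fun t => hv t (Set.mem_univ t)
    rw [e, map_zero, ← h fun t => (a (Sum.inl t) : ℂ) + Complex.I * a (Sum.inr t)]
    congr 3
    · funext t; simp [← ha]
    · funext t; simp [← ha, sub_eq_add_neg]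
  refine MvPolynomial.funext fun v => ?_
  have h1 := e (Sum.elim (fun t => (v (Sum.inl t) + v (Sum.inr t)) / 2)
    (fun t => (v (Sum.inl t) - v (Sum.inr t)) / (2 * Complex.I)))
  rw [h0, map_zero] at h1
  rw [map_zero, h1]
  congr 2
  funext t
  rcases t with t | t <;> simp <;> field_simp <;> ring

/-- The squared modulus of a complex polynomial in `z` and `conj z` is a real polynomial in the
real and imaginary parts of `z`. -/
lemma exists_evalReIm_eq_normSq {W : ℕ} (Q : MvPolynomial ((Fin 3 × Fin W) ⊕ (Fin 3 × Fin W)) ℂ) :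
    ∃ q : MvPolynomial ((Fin 3 × Fin W) ⊕ (Fin 3 × Fin W)) ℝ, ∀ z : Fin 3 → Fin W → ℂ,
      evalReIm q z = Complex.normSq (MvPolynomial.eval (Sum.elim (fun a => z a.1 a.2)
        (fun a => star (z a.1 a.2))) Q) := by
  suffices h : ∃ q₁ q₂ : MvPolynomial ((Fin 3 × Fin W) ⊕ (Fin 3 × Fin W)) ℝ,
      ∀ z : Fin 3 → Fin W → ℂ, MvPolynomial.eval (Sum.elim (fun a => z a.1 a.2)
        (fun a => star (z a.1 a.2))) Q = ⟨evalReIm q₁ z, evalReIm q₂ z⟩ by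
    obtain ⟨q₁, q₂, h⟩ := h
    refine ⟨q₁ * q₁ + q₂ * q₂, fun z => ?_⟩
    rw [h, Complex.normSq_mk]
    simp [evalReIm]
  induction Q using MvPolynomial.induction_on with
  | C a =>
    exact ⟨MvPolynomial.C a.re, MvPolynomial.C a.im, fun z => by simp [evalReIm]⟩
  | add p q hp hq =>
    obtain ⟨a, b, h⟩ := hp
    obtain ⟨a', b', h'⟩ := hq
    refine ⟨a + a', b + b', fun z => ?_⟩
    rw [map_add, h, h']
    apply Complex.ext <;> simp [evalReIm]
  | mul_X p t hp =>
    obtain ⟨a, b, h⟩ := hp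
    rcases t with t | t
    · refine ⟨a * MvPolynomial.X (Sum.inl t) - b * MvPolynomial.X (Sum.inr t),
        a * MvPolynomial.X (Sum.inr t) + b * MvPolynomial.X (Sum.inl t), fun z => ?_⟩
      rw [map_mul, h]
      apply Complex.ext <;> simp [evalReIm]
    · refine ⟨a * MvPolynomial.X (Sum.inl t) + b * MvPolynomial.X (Sum.inr t),
        b * MvPolynomial.X (Sum.inl t) - a * MvPolynomial.X (Sum.inr t), fun z => ?_⟩
      rw [map_mul, h]
      apply Complex.ext <;> simp [evalReIm]
      ring

/-! ### Cross relations for products `(X + ε) ^ l * (X + η) ^ k` -/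

open Polynomial in
/-- The coefficient of `X ^ n` in `(X + ε) ^ l * (X + η) ^ k`, as a polynomial in `ε`. -/
noncomputable def scaledCoeff (l k : ℕ) (η : ℂ) (n : ℕ) : ℂ[X] :=
  ∑ e ∈ Finset.range (l + 1), monomial e
    (if l ≤ n + e then (l.choose e : ℂ) * k.choose (n + e - l) * η ^ (k - (n + e - l)) else 0)

lemma eval_scaledCoeff (l k : ℕ) (η : ℂ) (n : ℕ) (ε : ℂ) :
    (scaledCoeff l k η n).eval ε =
      ((Polynomial.X + Polynomial.C ε) ^ l * (Polynomial.X + Polynomial.C η) ^ k).coeff n := by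
  rw [scaledCoeff, Polynomial.eval_finsetSum, add_comm Polynomial.X (Polynomial.C ε), add_pow,
    Finset.sum_mul, Polynomial.finsetSum_coeff]
  refine Finset.sum_congr rfl fun e he => ?_
  have he' : e ≤ l := by simpa [Nat.lt_succ_iff] using he
  have h1 : Polynomial.C ε ^ e * Polynomial.X ^ (l - e) * ((l.choose e : ℕ) : Polynomial ℂ) *
      (Polynomial.X + Polynomial.C η) ^ k = Polynomial.C (ε ^ e * (l.choose e : ℂ)) *
      ((Polynomial.X + Polynomial.C η) ^ k * Polynomial.X ^ (l - e)) := by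
    rw [map_mul, map_pow, map_natCast]; ring
  rw [h1, Polynomial.coeff_C_mul, Polynomial.coeff_mul_X_pow', Polynomial.eval_monomial,
    Polynomial.coeff_X_add_C_pow]
  by_cases h : l ≤ n + e
  · rw [if_pos h, if_pos (by omega), show n - (l - e) = n + e - l by omega]; ring
  · rw [if_neg h, if_neg (by omega)]; ring

lemma coeff_scaledCoeff (l k : ℕ) (η : ℂ) (n e : ℕ) :
    (scaledCoeff l k η n).coeff e = if e ≤ l ∧ l ≤ n + e then
      (l.choose e : ℂ) * k.choose (n + e - l) * η ^ (k - (n + e - l)) else 0 := by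
  simp only [scaledCoeff, Polynomial.finsetSum_coeff, Polynomial.coeff_monomial,
    Finset.sum_ite_eq', Finset.mem_range, Nat.lt_succ_iff]
  split_ifs <;> simp_all

lemma coeff_scaledCoeff_ne_zero {l k : ℕ} {η : ℂ} (hη : η ≠ 0) {n e : ℕ} (h₁ : e ≤ l)
    (h₂ : l ≤ n + e) (h₃ : n + e ≤ l + k) : (scaledCoeff l k η n).coeff e ≠ 0 := by
  rw [coeff_scaledCoeff, if_pos ⟨h₁, h₂⟩]
  refine mul_ne_zero (mul_ne_zero ?_ ?_) (pow_ne_zero _ hη)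
  · exact_mod_cast (Nat.choose_pos h₁).ne'
  · exact_mod_cast (Nat.choose_pos (by omega)).ne'

lemma natTrailingDegree_scaledCoeff {l k : ℕ} {η : ℂ} (hη : η ≠ 0) {n : ℕ} (hn : n ≤ l + k) :
    (scaledCoeff l k η n).natTrailingDegree = l - n := by
  have h := coeff_scaledCoeff_ne_zero hη (n := n) (e := l - n) (l := l) (k := k)
    (by omega) (by omega) (by omega)
  refine le_antisymm (Polynomial.natTrailingDegree_le_of_ne_zero h) ?_
  refine Polynomial.le_natTrailingDegree (fun h0 => h (by rw [h0, Polynomial.coeff_zero])) ?_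
  intro m hm
  rw [coeff_scaledCoeff, if_neg (by omega)]

lemma natDegree_scaledCoeff {l k : ℕ} {η : ℂ} (hη : η ≠ 0) {n : ℕ} (hn : n ≤ l + k) :
    (scaledCoeff l k η n).natDegree = min l (l + k - n) := by
  have h := coeff_scaledCoeff_ne_zero hη (n := n) (e := min l (l + k - n)) (l := l) (k := k)
    (by omega) (by omega) (by omega)
  refine le_antisymm ?_ (Polynomial.le_natDegree_of_ne_zero h)
  rw [Polynomial.natDegree_le_iff_coeff_eq_zero]
  intro m hm
  rw [coeff_scaledCoeff]
  split_ifs with h1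
  · rw [Nat.choose_eq_zero_of_lt (by omega : k < n + m - l)]; simp
  · rfl

lemma scaledCoeff_ne_zero {l k : ℕ} {η : ℂ} (hη : η ≠ 0) {n : ℕ} (hn : n ≤ l + k) :
    scaledCoeff l k η n ≠ 0 := by
  intro h0
  have h := coeff_scaledCoeff_ne_zero hη (n := n) (e := l - n) (l := l) (k := k)
    (by omega) (by omega) (by omega)
  exact h (by rw [h0, Polynomial.coeff_zero])

lemma trailingCoeff_scaledCoeff {l k : ℕ} {η : ℂ} (hη : η ≠ 0) {n : ℕ} (hn : n ≤ l + k) :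
    ∃ p : ℝ, 0 < p ∧ (scaledCoeff l k η n).trailingCoeff = p * η ^ (k - (n - l)) := by
  refine ⟨l.choose (l - n) * k.choose (n - l), ?_, ?_⟩
  · have h1 := Nat.choose_pos (show l - n ≤ l by omega)
    have h2 := Nat.choose_pos (show n - l ≤ k by omega)
    positivity
  · rw [Polynomial.trailingCoeff, natTrailingDegree_scaledCoeff hη hn, coeff_scaledCoeff,
      if_pos (by omega), show n + (l - n) - l = n - l by omega]
    push_cast; ring

/-- The cross ratio of two consecutive binomial relations between the coefficients of a triple
of polynomials. -/
def crossRelation {R : Type*} [CommRing R] (α i : ℕ) (f : Fin 3 → ℕ → R) : R :=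
  f 0 i * f 0 (α + i) * f 2 (i + 1) * f 1 (α + i + 1) -
    f 0 (i + 1) * f 0 (α + i + 1) * f 2 i * f 1 (α + i)

/-- Taking norms forces `p = q`; thus positive binomial factors cannot hide a nontrivial phase. -/
lemma eq_one_of_pos_mul_eq {η : ℂ} (hη : ‖η‖ = 1) {p q : ℝ} (hp : 0 < p) (hq : 0 < q)
    (h : (p : ℂ) = q * η) : η = 1 := by
  have h1 := congrArg norm h
  rw [norm_mul, hη, mul_one, Complex.norm_of_nonneg hp.le, Complex.norm_of_nonneg hq.le] at h1
  subst h1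
  have : (p : ℂ) ≠ 0 := by exact_mod_cast hp.ne'
  field_simp at h
  exact h.symm

lemma natTrailingDegree_mul_four {R : Type*} [CommRing R] [IsDomain R] {a b c d : Polynomial R}
    (ha : a ≠ 0) (hb : b ≠ 0) (hc : c ≠ 0) (hd : d ≠ 0) : (a * b * c * d).natTrailingDegree =
      a.natTrailingDegree + b.natTrailingDegree + c.natTrailingDegree + d.natTrailingDegree := by
  rw [Polynomial.natTrailingDegree_mul (mul_ne_zero (mul_ne_zero ha hb) hc) hd,
    Polynomial.natTrailingDegree_mul (mul_ne_zero ha hb) hc, Polynomial.natTrailingDegree_mul ha hb]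

lemma natDegree_mul_four {R : Type*} [CommRing R] [IsDomain R] {a b c d : Polynomial R}
    (ha : a ≠ 0) (hb : b ≠ 0) (hc : c ≠ 0) (hd : d ≠ 0) : (a * b * c * d).natDegree =
      a.natDegree + b.natDegree + c.natDegree + d.natDegree := by
  rw [Polynomial.natDegree_mul (mul_ne_zero (mul_ne_zero ha hb) hc) hd,
    Polynomial.natDegree_mul (mul_ne_zero ha hb) hc, Polynomial.natDegree_mul ha hb]

/-- If every cross relation vanished, its two products would agree in order, degree and trailing
coefficient in `ε`. When `l 0` is `0` or `d`, orders and degrees at the two extreme indices force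
all `l j` to be `0` or all to be `d`. Otherwise trailing coefficients at a suitable index force `η 1
= 1` or `η 2 = 1`. -/
lemma exists_crossRelation_scaledCoeff_ne_zero {d α : ℕ} (hα : 1 ≤ α) (hd : α < d)
    {η : Fin 3 → ℂ} (hη : ∀ j, ‖η j‖ = 1) (h0 : η 0 = 1) (h1 : η 1 ≠ 1) (h2 : η 2 ≠ 1)
    {l k : Fin 3 → ℕ} (hlk : ∀ j, l j + k j = d) (hk : ∃ j, k j ≠ 0) (hl : ∃ j, l j ≠ 0) :
    ∃ i, α + i < d ∧ crossRelation α i (fun j n => scaledCoeff (l j) (k j) (η j) n) ≠ 0 := by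
  have hη0 : ∀ j, η j ≠ 0 := fun j h => by simpa [h] using hη j
  have hne : ∀ {j n}, n ≤ d → scaledCoeff (l j) (k j) (η j) n ≠ 0 := fun {j n} h =>
    scaledCoeff_ne_zero (hη0 j) (by rw [hlk]; exact h)
  have htr : ∀ {j n}, n ≤ d → (scaledCoeff (l j) (k j) (η j) n).natTrailingDegree = l j - n :=
    fun {j n} h => natTrailingDegree_scaledCoeff (hη0 j) (by rw [hlk]; exact h)
  have hdeg : ∀ {j n}, n ≤ d → (scaledCoeff (l j) (k j) (η j) n).natDegree = min (l j) (d - n) :=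
    fun {j n} h => by rw [natDegree_scaledCoeff (hη0 j) (by rw [hlk]; exact h), hlk]
  by_contra! H
  have key : ∀ i, α + i < d → _ := fun i hi => sub_eq_zero.1 (H i hi)
  have T : ∀ i, α + i < d →
      (l 0 - i) + (l 0 - (α + i)) + (l 2 - (i + 1)) + (l 1 - (α + i + 1)) =
      (l 0 - (i + 1)) + (l 0 - (α + i + 1)) + (l 2 - i) + (l 1 - (α + i)) := by
    intro i hi
    have n0 := hne (j := 0) (n := i) (by omega)
    have n1 := hne (j := 0) (n := α + i) (by omega)
    have n2 := hne (j := 2) (n := i + 1) (by omega)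
    have n3 := hne (j := 1) (n := α + i + 1) (by omega)
    have n4 := hne (j := 0) (n := i + 1) (by omega)
    have n5 := hne (j := 0) (n := α + i + 1) (by omega)
    have n6 := hne (j := 2) (n := i) (by omega)
    have n7 := hne (j := 1) (n := α + i) (by omega)
    have := congrArg Polynomial.natTrailingDegree (key i hi)
    rwa [natTrailingDegree_mul_four n0 n1 n2 n3, natTrailingDegree_mul_four n4 n5 n6 n7,
      htr (by omega), htr (by omega), htr (by omega), htr (by omega), htr (by omega),
      htr (by omega), htr (by omega), htr (by omega)] at this
  have D : ∀ i, α + i < d →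
      min (l 0) (d - i) + min (l 0) (d - (α + i)) + min (l 2) (d - (i + 1)) +
        min (l 1) (d - (α + i + 1)) =
      min (l 0) (d - (i + 1)) + min (l 0) (d - (α + i + 1)) + min (l 2) (d - i) +
        min (l 1) (d - (α + i)) := by
    intro i hi
    have n0 := hne (j := 0) (n := i) (by omega)
    have n1 := hne (j := 0) (n := α + i) (by omega)
    have n2 := hne (j := 2) (n := i + 1) (by omega)
    have n3 := hne (j := 1) (n := α + i + 1) (by omega)
    have n4 := hne (j := 0) (n := i + 1) (by omega)
    have n5 := hne (j := 0) (n := α + i + 1) (by omega)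
    have n6 := hne (j := 2) (n := i) (by omega)
    have n7 := hne (j := 1) (n := α + i) (by omega)
    have := congrArg Polynomial.natDegree (key i hi)
    rwa [natDegree_mul_four n0 n1 n2 n3, natDegree_mul_four n4 n5 n6 n7,
      hdeg (by omega), hdeg (by omega), hdeg (by omega), hdeg (by omega), hdeg (by omega),
      hdeg (by omega), hdeg (by omega), hdeg (by omega)] at this
  have e0 := hlk 0
  have e1 := hlk 1
  have e2 := hlk 2
  rcases Nat.eq_zero_or_pos (l 0) with hl0 | hl0
  · have a := T 0 (by omega)
    have b := D (d - α - 1) (by omega)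
    obtain ⟨j, hj⟩ := hl
    fin_cases j <;> simp at hj <;> omega
  rcases Nat.eq_zero_or_pos (k 0) with hk0 | hk0
  · have a := D 0 (by omega)
    have b := T (d - α - 1) (by omega)
    obtain ⟨j, hj⟩ := hk
    fin_cases j <;> simp at hj <;> omega
  -- For this `i` the order of the index-0 factors drops by exactly one between `i` and `i + 1`, so
  -- by `T` exactly one of the factors for `z 1`, `z 2` drops as well.
  obtain ⟨i, hi, hi1, hi2⟩ : ∃ i, α + i < d ∧ i + 1 ≤ l 0 ∧ l 0 < α + i + 1 := by
    by_cases h : l 0 ≤ d - α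
    · exact ⟨l 0 - 1, by omega, by omega, by omega⟩
    · exact ⟨d - α - 1, by omega, by omega, by omega⟩
  have t := T i hi
  have tc := congrArg Polynomial.trailingCoeff (key i hi)
  simp only [Polynomial.trailingCoeff_mul] at tc
  have htc : ∀ j n, n ≤ d → ∃ p : ℝ, 0 < p ∧ (scaledCoeff (l j) (k j) (η j) n).trailingCoeff =
      p * η j ^ (k j - (n - l j)) :=
    fun j n h => trailingCoeff_scaledCoeff (hη0 j) (by rw [hlk]; exact h)
  obtain ⟨p0, q0, r0⟩ := htc 0 i (by omega)
  obtain ⟨p1, q1, r1⟩ := htc 0 (α + i) (by omega)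
  obtain ⟨p2, q2, r2⟩ := htc 2 (i + 1) (by omega)
  obtain ⟨p3, q3, r3⟩ := htc 1 (α + i + 1) (by omega)
  obtain ⟨p4, q4, r4⟩ := htc 0 (i + 1) (by omega)
  obtain ⟨p5, q5, r5⟩ := htc 0 (α + i + 1) (by omega)
  obtain ⟨p6, q6, r6⟩ := htc 2 i (by omega)
  obtain ⟨p7, q7, r7⟩ := htc 1 (α + i) (by omega)
  rw [r0, r1, r2, r3, r4, r5, r6, r7, h0] at tc
  simp only [one_pow, mul_one] at tc
  -- The factor whose order does not drop is the one whose power of `η` changes, by exactly one; all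
  -- other phases cancel.
  rcases lt_or_ge (l 2) (i + 1) with h | h
  · have ha : k 1 - (α + i + 1 - l 1) = k 1 - (α + i - l 1) := by omega
    have hb : k 2 - (i - l 2) = k 2 - (i + 1 - l 2) + 1 := by omega
    rw [ha, hb, pow_succ] at tc
    refine h2 (eq_one_of_pos_mul_eq (hη 2) (p := p0 * p1 * p2 * p3) (q := p4 * p5 * p6 * p7)
      (by positivity) (by positivity) ?_)
    have u1 := pow_ne_zero (k 1 - (α + i - l 1)) (hη0 1)
    have u2 := pow_ne_zero (k 2 - (i + 1 - l 2)) (hη0 2)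
    refine mul_right_cancel₀ (mul_ne_zero u1 u2) ?_
    push_cast
    linear_combination tc
  · have ha : k 1 - (α + i - l 1) = k 1 - (α + i + 1 - l 1) + 1 := by omega
    have hb : k 2 - (i + 1 - l 2) = k 2 - (i - l 2) := by omega
    rw [ha, hb, pow_succ] at tc
    refine h1 (eq_one_of_pos_mul_eq (hη 1) (p := p0 * p1 * p2 * p3) (q := p4 * p5 * p6 * p7)
      (by positivity) (by positivity) ?_)
    have u1 := pow_ne_zero (k 1 - (α + i + 1 - l 1)) (hη0 1)
    have u2 := pow_ne_zero (k 2 - (i - l 2)) (hη0 2)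
    refine mul_right_cancel₀ (mul_ne_zero u1 u2) ?_
    push_cast
    linear_combination tc

lemma exists_crossRelation_ne_zero {d α : ℕ} (hα : 1 ≤ α) (hd : α < d)
    {η : Fin 3 → ℂ} (hη : ∀ j, ‖η j‖ = 1) (h0 : η 0 = 1) (h1 : η 1 ≠ 1) (h2 : η 2 ≠ 1)
    {l k : Fin 3 → ℕ} (hlk : ∀ j, l j + k j = d) (hk : ∃ j, k j ≠ 0) (hl : ∃ j, l j ≠ 0) :
    ∃ i, α + i < d ∧ ∃ ε : ℂ, crossRelation α i (fun j n =>
      ((Polynomial.X + Polynomial.C ε) ^ l j * (Polynomial.X + Polynomial.C (η j)) ^ k j).coeff n)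
        ≠ 0 := by
  obtain ⟨i, hi, h⟩ := exists_crossRelation_scaledCoeff_ne_zero hα hd hη h0 h1 h2 hlk hk hl
  refine ⟨i, hi, ?_⟩
  by_contra! H
  refine h (Polynomial.funext fun ε => ?_)
  rw [Polynomial.eval_zero, ← H ε]
  simp only [crossRelation, Polynomial.eval_sub, Polynomial.eval_mul, eval_scaledCoeff]

/-! ### Fourier intensities and root selection -/

/-- The polynomial with coefficient vector `y`. -/
noncomputable def vecPoly {d : ℕ} {R : Type*} [CommRing R] (y : Fin (d + 1) → R) : Polynomial R :=
  ∑ n, Polynomial.C (y n) * Polynomial.X ^ (n : ℕ)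

lemma coeff_vecPoly {d : ℕ} {R : Type*} [CommRing R] (y : Fin (d + 1) → R) (n : ℕ) :
    (vecPoly y).coeff n = if h : n < d + 1 then y ⟨n, h⟩ else 0 := by
  simp only [vecPoly, Polynomial.finsetSum_coeff, Polynomial.coeff_C_mul, Polynomial.coeff_X_pow]
  split_ifs with h
  · rw [Finset.sum_eq_single ⟨n, h⟩]
    · simp
    · intro b _ hb
      rw [if_neg, mul_zero]
      rintro rfl; exact hb rfl
    · simp
  · refine Finset.sum_eq_zero fun b _ => ?_
    rw [if_neg, mul_zero]
    have := b.2
    omega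

lemma coeff_vecPoly_fin {d : ℕ} {R : Type*} [CommRing R] (y : Fin (d + 1) → R)
    (n : Fin (d + 1)) : (vecPoly y).coeff n = y n := by
  rw [coeff_vecPoly, dif_pos n.2]

lemma natDegree_vecPoly {d : ℕ} {y : Fin (d + 1) → ℂ} (hy : y (Fin.last d) ≠ 0) :
    (vecPoly y).natDegree = d := by
  refine le_antisymm ?_ (Polynomial.le_natDegree_of_ne_zero ?_)
  · rw [Polynomial.natDegree_le_iff_coeff_eq_zero]
    intro m hm
    rw [coeff_vecPoly, dif_neg (by omega)]
  · rwa [← coeff_vecPoly_fin y (Fin.last d)] at hy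

lemma leadingCoeff_vecPoly {d : ℕ} {y : Fin (d + 1) → ℂ} (hy : y (Fin.last d) ≠ 0) :
    (vecPoly y).leadingCoeff = y (Fin.last d) := by
  rw [Polynomial.leadingCoeff, natDegree_vecPoly hy, ← coeff_vecPoly_fin y (Fin.last d),
    Fin.val_last]

/-- The reversed conjugate of a vector. -/
noncomputable def conjRev {d : ℕ} (y : Fin (d + 1) → ℂ) : Fin (d + 1) → ℂ :=
  fun n => star (y n.rev)

lemma eval_vecPoly_conjRev {d : ℕ} (y : Fin (d + 1) → ℂ) (ω : Circle) :
    (vecPoly (conjRev y)).eval (ω : ℂ) = (ω : ℂ) ^ d * star ((vecPoly y).eval (ω : ℂ)) := by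
  have hω : (ω : ℂ) * star (ω : ℂ) = 1 := by
    rw [Complex.star_def, Complex.mul_conj, Circle.normSq_coe]; simp
  simp only [vecPoly, conjRev, Polynomial.eval_finsetSum, Polynomial.eval_mul, Polynomial.eval_C,
    Polynomial.eval_pow, Polynomial.eval_X, star_sum, star_mul', star_pow, Finset.mul_sum]
  rw [← Equiv.sum_comp Fin.revPerm]
  refine Finset.sum_congr rfl fun n _ => ?_
  have hn := n.2
  have : (ω : ℂ) ^ d = (ω : ℂ) ^ (d - (n : ℕ)) * (ω : ℂ) ^ (n : ℕ) := by
    rw [← pow_add]; congr 1; omega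
  rw [this, Fin.revPerm_apply, Fin.rev_rev, Fin.val_rev, show d + 1 - (n + 1) = d - n by omega]
  have h2 : (ω : ℂ) ^ (n : ℕ) * star (ω : ℂ) ^ (n : ℕ) = 1 := by rw [← mul_pow, hω, one_pow]
  linear_combination -(star (y n) * (ω : ℂ) ^ (d - (n : ℕ))) * h2

instance : Infinite Circle :=
  haveI : Infinite (Set.Ioc (-Real.pi) Real.pi) :=
    (Set.Ioc_infinite (by linarith [Real.pi_pos])).to_subtype
  Infinite.of_injective _ Circle.argEquiv.symm.injective

/-- At each `ω` on the circle both products equal `ω ^ d` times the intensity, and the circle is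
infinite. -/
lemma vecPoly_mul_conjRev_eq {d : ℕ} {y y' : Fin (d + 1) → ℂ}
    (h : fourierIntensity y' = fourierIntensity y) :
    vecPoly y' * vecPoly (conjRev y') = vecPoly y * vecPoly (conjRev y) := by
  refine Polynomial.eq_of_infinite_eval_eq _ _ (Set.Infinite.mono ?_
    (Set.infinite_range_of_injective (f := fun ω : Circle => (ω : ℂ)) Circle.coe_injective))
  rintro _ ⟨ω, rfl⟩
  have e : ∀ v : Fin (d + 1) → ℂ, (vecPoly v * vecPoly (conjRev v)).eval (ω : ℂ) =
      (ω : ℂ) ^ d * (fourierIntensity v ω : ℂ) := by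
    intro v
    rw [Polynomial.eval_mul, eval_vecPoly_conjRev, mul_left_comm, Complex.star_def,
      Complex.mul_conj']
    simp [fourierIntensity, vecPoly, Polynomial.eval_finsetSum]
  rw [Set.mem_ofPred_eq, e, e, h]

/-- The product of the first `l` factors `X - r i` and the first `k` factors `X - s i`. -/
noncomputable def selPoly {R : Type*} [CommRing R] {d l k : ℕ} (hl : l ≤ d) (hk : k ≤ d)
    (r s : Fin d → R) : Polynomial R :=
  (∏ i : Fin l, (Polynomial.X - Polynomial.C (r (Fin.castLE hl i)))) *
    ∏ i : Fin k, (Polynomial.X - Polynomial.C (s (Fin.castLE hk i)))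

lemma map_selPoly {R S : Type*} [CommRing R] [CommRing S] (φ : R →+* S) {d l k : ℕ} (hl : l ≤ d)
    (hk : k ≤ d) (r s : Fin d → R) :
    (selPoly hl hk r s).map φ = selPoly hl hk (φ ∘ r) (φ ∘ s) := by
  simp [selPoly, Polynomial.map_mul, Polynomial.map_prod]

lemma exists_fin_enumeration {A : Type*} (m : Multiset A) :
    ∃ r : Fin (Multiset.card m) → A, Finset.univ.val.map r = m := by
  induction m using Quot.inductionOn with
  | h L =>
    refine ⟨L.get, ?_⟩
    change Finset.univ.val.map L.get = (L : Multiset A)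
    rw [Fin.univ_val_map, List.ofFn_get]

/-- Listing the sub-multiset first makes every selection an initial segment, so the type of an
exchange is recorded by counts alone. -/
lemma exists_fin_enumeration_of_le {m m' : Multiset ℂ} (h : m ≤ m') {d : ℕ}
    (hd : Multiset.card m' = d) :
    ∃ (hl : Multiset.card m ≤ d) (r : Fin d → ℂ),
      (m'.map fun a => Polynomial.X - Polynomial.C a).prod =
        ∏ i, (Polynomial.X - Polynomial.C (r i)) ∧
      (m.map fun a => Polynomial.X - Polynomial.C a).prod =
        ∏ i, (Polynomial.X - Polynomial.C (r (Fin.castLE hl i))) := by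
  obtain ⟨t, rfl⟩ := Multiset.le_iff_exists_add.1 h
  rw [Multiset.card_add] at hd
  subst hd
  obtain ⟨r₁, h₁⟩ := exists_fin_enumeration m
  obtain ⟨r₂, h₂⟩ := exists_fin_enumeration t
  have e₁ : (m.map fun a => Polynomial.X - Polynomial.C a).prod =
      ∏ i, (Polynomial.X - Polynomial.C (r₁ i)) := by
    conv_lhs => rw [← h₁, Multiset.map_map]
    rfl
  have e₂ : (t.map fun a => Polynomial.X - Polynomial.C a).prod =
      ∏ i, (Polynomial.X - Polynomial.C (r₂ i)) := by
    conv_lhs => rw [← h₂, Multiset.map_map]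
    rfl
  refine ⟨by omega, Fin.append r₁ r₂, ?_, ?_⟩
  · rw [Multiset.map_add, Multiset.prod_add, e₁, e₂, Fin.prod_univ_add]
    simp
  · rw [e₁]
    refine Finset.prod_congr rfl fun i _ => ?_
    rw [show Fin.castLE _ i = Fin.castAdd (Multiset.card t) i from rfl, Fin.append_left]

lemma vecPoly_eq_prod_roots {d : ℕ} {y : Fin (d + 1) → ℂ} (hy : y (Fin.last d) ≠ 0) :
    Multiset.card (vecPoly y).roots = d ∧ vecPoly y = Polynomial.C (y (Fin.last d)) *
      ((vecPoly y).roots.map fun a => Polynomial.X - Polynomial.C a).prod := by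
  have hs := IsAlgClosed.splits (vecPoly y)
  refine ⟨by rw [← hs.natDegree_eq_card_roots, natDegree_vecPoly hy], ?_⟩
  conv_lhs => rw [hs.eq_prod_roots, leadingCoeff_vecPoly hy]

/-- A vector with the same Fourier intensity as `y` is obtained, up to a scalar, by selecting some
roots of the polynomial of `y` and some roots of that of the reversed conjugate of `y`. -/
lemma exists_root_selection {d : ℕ} {y y' : Fin (d + 1) → ℂ}
    (h : fourierIntensity y' = fourierIntensity y) (h0 : y 0 ≠ 0) (hd : y (Fin.last d) ≠ 0) :
    ∃ (l k : ℕ) (hl : l ≤ d) (hk : k ≤ d) (r s : Fin d → ℂ) (c : ℂ), l + k = d ∧ c ≠ 0 ∧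
      vecPoly y = Polynomial.C (y (Fin.last d)) * ∏ i, (Polynomial.X - Polynomial.C (r i)) ∧
      vecPoly (conjRev y) = Polynomial.C (star (y 0)) *
        ∏ i, (Polynomial.X - Polynomial.C (s i)) ∧
      vecPoly y' = Polynomial.C c * selPoly hl hk r s := by
  have hprod := vecPoly_mul_conjRev_eq h
  have hr0 : conjRev y (Fin.last d) = star (y 0) := by simp [conjRev]
  have hrd : conjRev y (Fin.last d) ≠ 0 := by rw [hr0]; simpa using h0
  -- The constant coefficients of the two products are `y' 0 * star (y' (Fin.last d))` and the same
  -- expression in `y`, which is nonzero.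
  have hd' : y' (Fin.last d) ≠ 0 := by
    intro h1
    have h2 := congrArg (fun p => p.coeff 0) hprod
    have h3 : ∀ v : Fin (d + 1) → ℂ, (vecPoly v).coeff 0 = v 0 := fun v =>
      coeff_vecPoly_fin v 0
    simp only [Polynomial.mul_coeff_zero, h3] at h2
    simp [conjRev, h1, h0, hd] at h2
  obtain ⟨c1, e1⟩ := vecPoly_eq_prod_roots hd
  obtain ⟨c2, e2⟩ := vecPoly_eq_prod_roots hrd
  obtain ⟨c3, e3⟩ := vecPoly_eq_prod_roots hd'
  have n1 : vecPoly y ≠ 0 := fun h => by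
    rw [← coeff_vecPoly_fin y, h] at hd; simp at hd
  have n2 : vecPoly (conjRev y) ≠ 0 := fun h => by
    rw [← coeff_vecPoly_fin (conjRev y), h] at hrd; simp at hrd
  have hle : (vecPoly y').roots ≤ (vecPoly y).roots + (vecPoly (conjRev y)).roots := by
    rw [← Polynomial.roots_mul (mul_ne_zero n1 n2)]
    refine Polynomial.roots.le_of_dvd (mul_ne_zero n1 n2) ?_
    rw [← hprod]
    exact dvd_mul_right _ _
  have m1 : (vecPoly y').roots ∩ (vecPoly y).roots ≤ (vecPoly y).roots :=
    Multiset.inter_le_right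
  -- Roots shared with `y` count as kept; the multiset difference must then come from the conjugate
  -- reversal.
  have m2 : (vecPoly y').roots - (vecPoly y).roots ≤ (vecPoly (conjRev y)).roots := by
    rw [tsub_le_iff_left]; exact hle
  have m3 := Multiset.sub_add_inter (vecPoly y').roots (vecPoly y).roots
  obtain ⟨hl, r, a1, a2⟩ := exists_fin_enumeration_of_le m1 c1
  obtain ⟨hk, s, b1, b2⟩ := exists_fin_enumeration_of_le m2 c2
  refine ⟨_, _, hl, hk, r, s, y' (Fin.last d), ?_, hd', ?_, ?_, ?_⟩
  · rw [add_comm, ← Multiset.card_add, m3, c3]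
  · rw [← a1]; exact e1
  · rw [← b1, ← hr0]; exact e2
  · rw [selPoly, ← a2, ← b2, mul_comm (Multiset.prod _), ← Multiset.prod_add,
      ← Multiset.map_add, m3]
    exact e3

/-! ### Binomial relations on `Z` -/

lemma crossRelation_map {R S : Type*} [CommRing R] [CommRing S] (φ : R →+* S) (α i : ℕ)
    (f : Fin 3 → ℕ → R) :
    φ (crossRelation α i f) = crossRelation α i (fun j n => φ (f j n)) := by
  simp [crossRelation]

lemma crossRelation_smul {R : Type*} [CommRing R] (α i : ℕ) (c : Fin 3 → R) (f : Fin 3 → ℕ → R) :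
    crossRelation α i (fun j n => c j * f j n) =
      (c 0 ^ 2 * c 1 * c 2) * crossRelation α i f := by
  simp only [crossRelation]; ring

/-- The binomial relations satisfied by the triples in the closure of the image. -/
def BinomialRelations {W : ℕ} (α : ℕ) (z : Fin 3 → Fin W → ℂ) : Prop :=
  ∀ n m : Fin W, (m : ℕ) = α + n → z 0 n * z 0 m = z 2 n * z 1 m

/-- Each relation is a closed condition. On the image both sides are the same monomial, because `-m
= -α - n` and `α - m = -n` when `m = α + n`. -/
lemma binomialRelations_of_mem {N W α : ℕ} {z : Fin 3 → Fin W → ℂ}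
    (hz : z ∈ tripleVariety N W α) : BinomialRelations α z := by
  intro n m hnm
  have hc : IsClosed {z : Fin 3 → Fin W → ℂ | z 0 n * z 0 m = z 2 n * z 1 m} :=
    isClosed_eq (by fun_prop) (by fun_prop)
  refine closure_minimal ?_ hc hz
  rintro _ ⟨⟨x, w⟩, rfl⟩
  simp only [Set.mem_ofPred_eq, tripleMap, windowedSection, Matrix.cons_val_zero,
    Matrix.cons_val_one, Matrix.cons_val]
  have e1 : ((0 - (m : ℕ) : ℤ) : ZMod N) = ((-(α : ℤ) - (n : ℕ) : ℤ) : ZMod N) := by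
    rw [hnm]; congr 1; push_cast; ring
  have e2 : (((α : ℤ) - (m : ℕ) : ℤ) : ZMod N) = ((0 - (n : ℕ) : ℤ) : ZMod N) := by
    rw [hnm]; congr 1; push_cast; ring
  rw [e1, e2]; ring

lemma crossRelation_eq_zero {d α i : ℕ} (hi : α + i < d) {z : Fin 3 → Fin (d + 1) → ℂ}
    (hz : BinomialRelations α z) : crossRelation α i (fun j n => (vecPoly (z j)).coeff n) = 0 := by
  have h1 := hz ⟨i, by omega⟩ ⟨α + i, by omega⟩ rfl
  have h2 := hz ⟨i + 1, by omega⟩ ⟨α + i + 1, by omega⟩ (by simp [add_assoc])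
  simp only [crossRelation, coeff_vecPoly]
  rw [dif_pos (by omega), dif_pos (by omega), dif_pos (by omega), dif_pos (by omega),
    dif_pos (by omega), dif_pos (by omega), dif_pos (by omega), dif_pos (by omega)]
  linear_combination z 2 ⟨i + 1, by omega⟩ * z 1 ⟨α + i + 1, by omega⟩ * h1 -
    z 2 ⟨i, by omega⟩ * z 1 ⟨α + i, by omega⟩ * h2

/-! ### Generic points through formal conjugates -/

/-- The polynomials in a triple `z` of vectors and its formal conjugate. -/
abbrev ConjPoly (d : ℕ) : Type :=
  MvPolynomial ((Fin 3 × Fin (d + 1)) ⊕ (Fin 3 × Fin (d + 1))) ℂ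

/-- The value of `Q` at a pair consisting of a triple and a formal conjugate. -/
noncomputable def evalPair {d : ℕ} (Q : ConjPoly d) (z z' : Fin 3 → Fin (d + 1) → ℂ) : ℂ :=
  MvPolynomial.eval (Sum.elim (fun a => z a.1 a.2) (fun a => z' a.1 a.2)) Q

/-- `Q` does not vanish identically on the complexification of the image of `tripleMap`. -/
def NonzeroOnImage (N d α : ℕ) (Q : ConjPoly d) : Prop :=
  ∃ p p' : (ZMod N → ℂ) × (Fin (d + 1) → ℂ),
    evalPair Q (tripleMap N (d + 1) α p) (tripleMap N (d + 1) α p') ≠ 0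

/-- Pulled back to two independent copies of the `(x, w)` variables, each `Q i` is nonzero, hence so
is their product in this domain. Some pair `(u, conj u)` avoids its zeros, and the squared modulus
supplies a real polynomial. -/
lemma exists_generic {N d α : ℕ} {ι : Type*} (s : Finset ι) (Q : ι → ConjPoly d)
    (hQ : ∀ i ∈ s, NonzeroOnImage N d α (Q i)) :
    ∃ q : MvPolynomial ((Fin 3 × Fin (d + 1)) ⊕ (Fin 3 × Fin (d + 1))) ℝ,
      (∃ z ∈ tripleVariety N (d + 1) α, evalReIm q z ≠ 0) ∧
      ∀ z, evalReIm q z ≠ 0 → ∀ i ∈ s, evalPair (Q i) z (fun j n => star (z j n)) ≠ 0 := by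
  obtain ⟨q, hq⟩ := exists_evalReIm_eq_normSq (∏ i ∈ s, Q i)
  refine ⟨q, ?_, ?_⟩
  · let k : Fin 3 → ℤ := ![0, α, -α]
    let c : Fin 3 × Fin (d + 1) → (ZMod N ⊕ Fin (d + 1)) × (ZMod N ⊕ Fin (d + 1)) := fun a =>
      (Sum.inl ((k a.1 - (a.2 : ℕ) : ℤ) : ZMod N), Sum.inr a.2)
    let Φ : ConjPoly d →ₐ[ℂ] MvPolynomial ((ZMod N ⊕ Fin (d + 1)) ⊕ (ZMod N ⊕ Fin (d + 1))) ℂ :=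
      MvPolynomial.bind₁ (Sum.elim
        (fun a => MvPolynomial.X (Sum.inl (c a).1) * MvPolynomial.X (Sum.inl (c a).2))
        (fun a => MvPolynomial.X (Sum.inr (c a).1) * MvPolynomial.X (Sum.inr (c a).2)))
    have ht : ∀ (p : (ZMod N → ℂ) × (Fin (d + 1) → ℂ)) (a : Fin 3 × Fin (d + 1)),
        tripleMap N (d + 1) α p a.1 a.2 = p.1 ((k a.1 - (a.2 : ℕ) : ℤ) : ZMod N) * p.2 a.2 := by
      rintro p ⟨j, n⟩
      fin_cases j <;> rfl
    have hΦ : ∀ (p p' : (ZMod N → ℂ) × (Fin (d + 1) → ℂ)) (R : ConjPoly d),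
        MvPolynomial.eval (Sum.elim (Sum.elim p.1 p.2) (Sum.elim p'.1 p'.2)) (Φ R) =
          evalPair R (tripleMap N (d + 1) α p) (tripleMap N (d + 1) α p') := by
      intro p p' R
      rw [evalPair, MvPolynomial.eval, MvPolynomial.eval₂Hom_bind₁]
      congr 2
      funext a
      rcases a with a | a <;> simp [c, ht]
    have hne : Φ (∏ i ∈ s, Q i) ≠ 0 := by
      rw [map_prod, Finset.prod_ne_zero_iff]
      intro i hi h0
      obtain ⟨p, p', hp⟩ := hQ i hi
      rw [← hΦ, h0, map_zero] at hp
      exact hp rfl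
    obtain ⟨u, hu⟩ := exists_eval_conj_ne_zero hne
    let p : (ZMod N → ℂ) × (Fin (d + 1) → ℂ) := (fun a => u (Sum.inl a), fun a => u (Sum.inr a))
    refine ⟨tripleMap N (d + 1) α p, subset_closure ⟨p, rfl⟩, ?_⟩
    rw [hq, ne_eq, Complex.normSq_eq_zero]
    convert hu using 1
    have e : Sum.elim u (fun t => star (u t)) = Sum.elim (Sum.elim p.1 p.2)
        (Sum.elim (fun a => star (p.1 a)) (fun a => star (p.2 a))) := by
      funext a
      rcases a with (a | a) | (a | a) <;> rfl
    rw [e, hΦ p (fun a => star (p.1 a), fun a => star (p.2 a)), evalPair]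
    refine iff_of_eq (congrArg (fun v => MvPolynomial.eval v (∏ i ∈ s, Q i) = 0)
      (funext fun a => ?_))
    rcases a with a | a <;> simp [ht]
  · intro z hz i hi h0
    apply hz
    rw [hq, map_prod, Finset.prod_eq_zero hi h0, map_zero]

/-! ### Excluding nontrivial exchanges -/

/-- A quadratic chirp `a ↦ ζ ^ (a ^ 2)` is well defined on `ZMod N` for a suitable root of unity
`ζ` whose square is primitive of order `N`. -/
lemma exists_chirp {N : ℕ} (hN : 0 < N) : ∃ (ζ : ℂ) (χ : ZMod N → ℂ), IsPrimitiveRoot (ζ ^ 2) N ∧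
    ‖ζ‖ = 1 ∧ ∀ a : ℤ, χ (a : ZMod N) = ζ ^ (a ^ 2) := by
  -- The factor `N + 1` in place of `1` gives `ζ ^ (N ^ 2) = (-1) ^ (N * (N + 1)) = 1`, so the chirp
  -- is periodic for odd `N` too.
  set ζ : ℂ := Complex.exp (Real.pi * Complex.I * (N + 1) / N) with hζ
  have hN0 : (N : ℂ) ≠ 0 := by exact_mod_cast hN.ne'
  have hsq : ζ ^ 2 = Complex.exp (2 * Real.pi * Complex.I / N) := by
    have h1 : ((2 : ℕ) : ℂ) * (Real.pi * Complex.I * (N + 1) / N) =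
        2 * Real.pi * Complex.I / N + 2 * Real.pi * Complex.I := by
      push_cast
      field_simp
      ring
    rw [hζ, ← Complex.exp_nat_mul, h1, Complex.exp_add, Complex.exp_two_pi_mul_I, mul_one]
  have hprim : IsPrimitiveRoot (ζ ^ 2) N := by
    rw [hsq]; exact Complex.isPrimitiveRoot_exp N hN.ne'
  have hnorm : ‖ζ‖ = 1 := by
    have h1 := hprim.norm'_eq_one hN.ne'
    rw [norm_pow] at h1
    exact (pow_eq_one_iff_of_nonneg (norm_nonneg _) two_ne_zero).1 h1
  have hζ0 : ζ ≠ 0 := fun h => by simp [h] at hnorm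
  have h2N : ζ ^ (2 * N) = 1 := by rw [pow_mul]; exact hprim.pow_eq_one
  have hNN : ζ ^ (N ^ 2) = 1 := by
    have h1 : ζ ^ N = Complex.exp (Real.pi * Complex.I) ^ (N + 1) := by
      rw [hζ, ← Complex.exp_nat_mul, ← Complex.exp_nat_mul]
      congr 1
      push_cast
      field_simp
    rw [sq, pow_mul, h1, Complex.exp_pi_mul_I, ← pow_mul]
    exact Even.neg_one_pow (by rw [mul_comm]; exact Nat.even_mul_succ_self N)
  have : NeZero N := ⟨hN.ne'⟩
  refine ⟨ζ, fun m => ζ ^ ((m.val : ℤ) ^ 2), hprim, hnorm, fun a => ?_⟩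
  have hv : (((a : ZMod N).val : ℕ) : ℤ) = a % N := ZMod.val_intCast a
  have hdecomp : a = a % N + N * (a / N) := (Int.emod_add_mul_ediv a N).symm
  have key : a ^ 2 = (a % N) ^ 2 + ((2 * N : ℕ) : ℤ) * ((a % N) * (a / N)) +
      ((N ^ 2 : ℕ) : ℤ) * (a / N) ^ 2 := by
    conv_lhs => rw [hdecomp]
    push_cast
    ring
  have hz1 : ∀ b : ℤ, ζ ^ (((2 * N : ℕ) : ℤ) * b) = 1 := fun b => by
    rw [zpow_mul, zpow_natCast, h2N, one_zpow]
  have hz2 : ∀ b : ℤ, ζ ^ (((N ^ 2 : ℕ) : ℤ) * b) = 1 := fun b => by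
    rw [zpow_mul, zpow_natCast, hNN, one_zpow]
  simp only [hv]
  rw [key, zpow_add₀ hζ0, zpow_add₀ hζ0, hz1, hz2, mul_one, mul_one]

/-- `Q` vanishes whenever some vectors obtained from the triple `z` by keeping `l j` roots of the
`j`-th polynomial and exchanging the others satisfy the binomial relations. -/
def VanishesOnExchange (d α : ℕ) (l : Fin 3 → ℕ) (Q : ConjPoly d) : Prop :=
  ∀ z z' : Fin 3 → Fin (d + 1) → ℂ, (∀ j, z j 0 ≠ 0) → (∀ j, z j (Fin.last d) ≠ 0) →
    BinomialRelations α z' →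
    (∀ j, ∃ (k : ℕ) (hl : l j ≤ d) (hk : k ≤ d) (r s : Fin d → ℂ) (c : ℂ), l j + k = d ∧ c ≠ 0 ∧
      vecPoly (z j) = Polynomial.C (z j (Fin.last d)) *
        ∏ i, (Polynomial.X - Polynomial.C (r i)) ∧
      vecPoly (conjRev (z j)) = Polynomial.C (star (z j 0)) *
        ∏ i, (Polynomial.X - Polynomial.C (s i)) ∧
      vecPoly (z' j) = Polynomial.C c * selPoly hl hk r s) →
    evalPair Q z (fun j n => star (z j n)) = 0

lemma rootCoeff_eq_div {d : ℕ} {y : Fin (d + 1) → ℂ} {a : ℂ} (ha : a ≠ 0) {r : Fin d → ℂ}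
    (h : vecPoly y = Polynomial.C a * ∏ i, (Polynomial.X - Polynomial.C (r i))) (n : Fin d) :
    rootCoeff r n = y n.castSucc / a := by
  have h1 := coeff_vecPoly_fin y n.castSucc
  rw [h, Polynomial.coeff_C_mul] at h1
  rw [← h1, rootCoeff]
  field_simp
  rfl

lemma rootCoeff_const {d : ℕ} (a : ℂ) (n : Fin d) :
    rootCoeff (fun _ : Fin d => -a) n = a ^ (d - (n : ℕ)) * d.choose n := by
  simp [rootCoeff, Polynomial.coeff_X_add_C_pow]

lemma crossRelation_selPoly_eq_zero {d α i : ℕ} (hi : α + i < d) {z : Fin 3 → Fin (d + 1) → ℂ}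
    (hz : BinomialRelations α z) {f : Fin 3 → Polynomial ℂ} {c : Fin 3 → ℂ} (hc : ∀ j, c j ≠ 0)
    (hf : ∀ j, vecPoly (z j) = Polynomial.C (c j) * f j) :
    crossRelation α i (fun j n => (f j).coeff n) = 0 := by
  have h := crossRelation_eq_zero hi hz
  simp only [hf, Polynomial.coeff_C_mul] at h
  rw [crossRelation_smul] at h
  exact (mul_eq_zero.1 h).resolve_left
    (mul_ne_zero (mul_ne_zero (pow_ne_zero _ (hc 0)) (hc 1)) (hc 2))

lemma tripleMap_apply {N W α : ℕ} (p : (ZMod N → ℂ) × (Fin W → ℂ)) (j : Fin 3) (n : Fin W) :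
    tripleMap N W α p j n = p.1 (((![0, α, -α] : Fin 3 → ℤ) j - (n : ℕ) : ℤ) : ZMod N) * p.2 n := by
  fin_cases j <;> rfl

/-- The witness pair is a constant signal, giving all `z j` the polynomial `(X + ε) ^ d`, and a
windowed chirp. A time shift of a chirp is a modulation, so the reversed chirp sections become
multiples of `(X + η j) ^ d` with `η 0 = 1` and the other two different from `1`. -/
lemma exists_exchange_mixed {N d α : ℕ} (hα : 1 ≤ α) (hd : α < d) (hN : α < N)
    {l : Fin 3 → ℕ} (hld : ∀ j, l j ≤ d) (hk : ∃ j, l j ≠ d) (hl : ∃ j, l j ≠ 0) :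
    ∃ Q : ConjPoly d, NonzeroOnImage N d α Q ∧ VanishesOnExchange d α l Q := by
  obtain ⟨ζ, χ, hprim, hζ, hχ⟩ := exists_chirp (show 0 < N by omega)
  have hζ0 : ζ ≠ 0 := fun h => by simp [h] at hζ
  set κ : Fin 3 → ℤ := ![0, α, -α] with hκ
  set η : Fin 3 → ℂ := fun j => ζ ^ (-(2 * κ j)) with hηdef
  have hζα : ζ ^ (2 * (α : ℤ)) ≠ 1 := by
    rw [zpow_mul, zpow_natCast]
    exact hprim.pow_ne_one_of_pos_of_lt (by omega) hN
  obtain ⟨i, hi, ε, hε⟩ := exists_crossRelation_ne_zero (d := d) hα hd (η := η) (l := l)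
    (k := fun j => d - l j) (fun j => by simp [hηdef, hζ]) (by simp [hηdef, hκ])
    (by simpa [hηdef, hκ, zpow_neg] using hζα) (by simpa [hηdef, hκ] using hζα)
    (fun j => by have := hld j; omega)
    (by obtain ⟨j, hj⟩ := hk; exact ⟨j, by have := hld j; omega⟩) hl
  let P : MvPolynomial ((Fin 3 ⊕ Fin 3) × Fin d) ℂ := crossRelation α i fun j n =>
    (selPoly (hld j) (Nat.sub_le d (l j)) (fun a => MvPolynomial.X (Sum.inl j, a))
      (fun a => MvPolynomial.X (Sum.inr j, a))).coeff n
  have hP : ∀ r : (Fin 3 ⊕ Fin 3) → Fin d → ℂ, MvPolynomial.eval (fun a => r a.1 a.2) P =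
      crossRelation α i fun j n => (selPoly (hld j) (Nat.sub_le d (l j)) (r (Sum.inl j))
        (r (Sum.inr j))).coeff n := by
    intro r
    rw [crossRelation_map]
    congr 1
    funext j n
    rw [← Polynomial.coeff_map, map_selPoly]
    congr 2 <;> funext a <;> simp
  obtain ⟨P', hP'⟩ := exists_elimination P
  let den : (Fin 3 ⊕ Fin 3) × Fin d → ConjPoly d := fun t => t.1.elim
    (fun j => MvPolynomial.X (Sum.inl (j, Fin.last d))) (fun j => MvPolynomial.X (Sum.inr (j, 0)))
  let num : (Fin 3 ⊕ Fin 3) × Fin d → ConjPoly d := fun t => t.1.elim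
    (fun j => MvPolynomial.X (Sum.inl (j, t.2.castSucc)))
    (fun j => MvPolynomial.X (Sum.inr (j, t.2.castSucc.rev)))
  let u : ConjPoly d := (∏ j, MvPolynomial.X (Sum.inl (j, Fin.last d))) *
    ∏ j, MvPolynomial.X (Sum.inr (j, 0))
  have hden : ∀ t, den t ∣ u := by
    rintro ⟨j | j, n⟩
    · exact Dvd.dvd.mul_right (Finset.dvd_prod_of_mem
        (fun j : Fin 3 => (MvPolynomial.X (Sum.inl (j, Fin.last d)) : ConjPoly d))
        (Finset.mem_univ j)) _
    · exact Dvd.dvd.mul_left (Finset.dvd_prod_of_mem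
        (fun j : Fin 3 => (MvPolynomial.X (Sum.inr (j, 0)) : ConjPoly d)) (Finset.mem_univ j)) _
  obtain ⟨D, Q, hQ⟩ := exists_clear_denominators u num den hden P'
  have hQ' : ∀ (z z' : Fin 3 → Fin (d + 1) → ℂ) (r : (Fin 3 ⊕ Fin 3) → Fin d → ℂ),
      (∀ j, z j (Fin.last d) ≠ 0) → (∀ j, z' j 0 ≠ 0) →
      (∀ j n, rootCoeff (r (Sum.inl j)) n = z j n.castSucc / z j (Fin.last d)) →
      (∀ j n, rootCoeff (r (Sum.inr j)) n = z' j n.castSucc.rev / z' j 0) →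
      (evalPair Q z z' = 0 ↔ MvPolynomial.eval (fun a => rootCoeff (r a.1) a.2) P' = 0) := by
    intro z z' r hz hz' h1 h2
    have hu : MvPolynomial.eval (Sum.elim (fun a => z a.1 a.2) (fun a => z' a.1 a.2)) u ≠ 0 := by
      simp only [u, map_mul, map_prod, MvPolynomial.eval_X, Sum.elim_inl, Sum.elim_inr]
      exact mul_ne_zero (Finset.prod_ne_zero_iff.2 fun j _ => hz j)
        (Finset.prod_ne_zero_iff.2 fun j _ => hz' j)
    rw [evalPair, hQ _ hu, mul_eq_zero, or_iff_right (pow_ne_zero _ hu)]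
    refine iff_of_eq (congrArg (fun v => MvPolynomial.eval v P' = 0) (funext fun a => ?_))
    rcases a with ⟨j | j, n⟩
    · simp [num, den, h1]
    · simp [num, den, h2]
  refine ⟨Q, ?_, ?_⟩
  · let w : Fin (d + 1) → ℂ := fun n => ε ^ (d - (n : ℕ)) * d.choose n
    -- The exponent cancels the part of `(κ j - n) ^ 2` quadratic in `d - n` and its linear part
    -- independent of `κ j`, leaving the ratio `ζ ^ (2 * κ j)`.
    let w' : Fin (d + 1) → ℂ := fun n =>
      ζ ^ (2 * (d : ℤ) * (d - (n : ℕ)) - (d - (n : ℕ) : ℤ) ^ 2) * d.choose n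
    let r : (Fin 3 ⊕ Fin 3) → Fin d → ℂ := Sum.elim (fun _ _ => -ε) (fun j _ => -η j)
    have hz' : ∀ j n, tripleMap N (d + 1) α (χ, w') j n =
        ζ ^ ((κ j - d) ^ 2 + 2 * κ j * (d - (n : ℕ))) * d.choose n := by
      intro j n
      rw [tripleMap_apply]
      simp only [w', ← hκ]
      rw [hχ, ← mul_assoc, ← zpow_add₀ hζ0]
      congr 2
      ring
    refine ⟨(fun _ => 1, w), (χ, w'), fun h0 => ?_⟩
    rw [hQ' _ _ r] at h0
    · obtain ⟨π, hπ⟩ := (hP' r).1 h0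
      -- Within each block all roots coincide, so reordering has no effect.
      have hr : ∀ a : (Fin 3 ⊕ Fin 3) × Fin d, r a.1 (π a.1 a.2) = r a.1 a.2 := by
        rintro ⟨j | j, n⟩ <;> rfl
      simp only [hr] at hπ
      rw [hP] at hπ
      refine hε (Eq.trans ?_ hπ)
      congr 1
      funext j n
      simp [r, selPoly]
    · intro j; simp [tripleMap_apply, w]
    · intro j
      rw [hz']
      simpa using zpow_ne_zero _ hζ0
    · intro j n
      simp only [r, Sum.elim_inl]
      rw [rootCoeff_const]
      simp [tripleMap_apply, w]
    · intro j n
      simp only [r, Sum.elim_inr]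
      have hn := n.2
      rw [rootCoeff_const, hz', hz', Fin.val_rev, Fin.val_castSucc,
        show d + 1 - ((n : ℕ) + 1) = d - n by omega, Nat.choose_symm hn.le, hηdef,
        ← zpow_natCast, ← zpow_mul]
      simp only [Fin.val_zero, Nat.choose_zero_right, Nat.cast_one, mul_one]
      rw [mul_div_right_comm, ← zpow_sub₀ hζ0]
      congr 2
      push_cast [hn.le]
      ring
  · intro z z' h0 hlast hrel hsel
    choose k hlj hkj r s c hlk hc hr hs hsel using hsel
    obtain rfl : k = fun j => d - l j := funext fun j => by have := hlk j; omega
    rw [hQ' z _ (Sum.elim r s) hlast (fun j => by simpa using h0 j)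
      (fun j n => by simpa using rootCoeff_eq_div (hlast j) (hr j) n)
      (fun j n => by
        simpa [conjRev] using rootCoeff_eq_div (star_ne_zero.2 (h0 j)) (hs j) n)]
    rw [hP']
    refine ⟨fun _ => 1, ?_⟩
    simp only [Equiv.Perm.coe_one, id_eq]
    rw [hP]
    exact crossRelation_selPoly_eq_zero hi hrel hc hsel

/-- With no root kept, `ε` disappears and the chirp witness satisfies every cross relation. Here the
exchanged triple is the conjugate reversal itself, so a single cross relation in the conjugate
variables suffices. -/
lemma exists_exchange_full {N d α : ℕ} (hα : 1 ≤ α) (hd : α < d) (hN : 3 * α ≤ N) :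
    ∃ Q : ConjPoly d, NonzeroOnImage N d α Q ∧ VanishesOnExchange d α (fun _ => 0) Q := by
  let Q : ConjPoly d := crossRelation α 0 fun j n => (vecPoly fun m : Fin (d + 1) =>
    (MvPolynomial.X (Sum.inr (j, m.rev)) : ConjPoly d)).coeff n
  have hQ : ∀ z z' : Fin 3 → Fin (d + 1) → ℂ, evalPair Q z z' =
      crossRelation α 0 fun j n => (vecPoly fun m => z' j m.rev).coeff n := by
    intro z z'
    rw [evalPair, crossRelation_map]
    congr 1
    funext j n
    simp only [coeff_vecPoly]
    split_ifs <;> simp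
  refine ⟨Q, ?_, ?_⟩
  · have hne : ∀ m : ℕ, 0 < m → m < N → ((m : ℕ) : ZMod N) ≠ 0 := by
      intro m h0 hm h
      exact absurd (Nat.le_of_dvd h0 ((ZMod.natCast_eq_zero_iff m N).1 h)) (by omega)
    have a1 := hne 1 (by omega) (by omega)
    have a2 := hne α (by omega) (by omega)
    have a3 := hne (α + 1) (by omega) (by omega)
    have a4 := hne (2 * α) (by omega) (by omega)
    push_cast at a1 a2 a3 a4
    -- The doubled sample is the one read by `f 0 (α + 1)`. No factor of the first product reads it,
    -- so that product is `1` while the second is at least `2`.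
    let x : ZMod N → ℂ := fun m => if m = α + 1 - d then 2 else 1
    refine ⟨(fun _ => 1, fun _ => 1), (x, fun _ => 1), ?_⟩
    have hx : ∀ (j : Fin 3) (n : ℕ) (hn : n < d + 1),
        (vecPoly fun m : Fin (d + 1) => tripleMap N (d + 1) α (x, fun _ => 1) j m.rev).coeff n =
          x (((![0, α, -α] : Fin 3 → ℤ) j : ZMod N) - d + n) := by
      intro j n hn
      rw [coeff_vecPoly, dif_pos hn, tripleMap_apply, mul_one, Fin.val_rev]
      refine congrArg x ?_
      rw [Nat.cast_sub (by omega)]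
      push_cast
      ring
    rw [hQ]
    simp only [crossRelation]
    rw [hx _ _ (by omega), hx _ _ (by omega), hx _ _ (by omega), hx _ _ (by omega),
      hx _ _ (by omega), hx _ _ (by omega), hx _ _ (by omega), hx _ _ (by omega)]
    simp only [x, Matrix.cons_val_zero, Matrix.cons_val_one, Matrix.cons_val]
    rw [if_neg (fun h => a3 (by push_cast at h; linear_combination -h)),
      if_neg (fun h => a1 (by push_cast at h; linear_combination -h)),
      if_neg (fun h => a4 (by push_cast at h; linear_combination -h)),
      if_neg (fun h => a2 (by push_cast at h; linear_combination h)),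
      if_pos (show (((0 : ℤ) : ZMod N) - d + ((α + 0 + 1 : ℕ) : ZMod N)) = α + 1 - d by
        push_cast; ring)]
    split_ifs <;> norm_num
  · intro z z' h0 hlast hrel hsel
    choose k hlj hkj r s c hlk hc hr hs hsel using hsel
    obtain rfl : k = fun j => d := funext fun j => by simpa using hlk j
    rw [hQ]
    refine crossRelation_selPoly_eq_zero (i := 0) (by omega) hrel
      (c := fun j => c j / star (z j 0))
      (f := fun j => vecPoly fun m => star (z j m.rev)) (fun j => ?_) fun j => ?_
    · exact div_ne_zero (hc j) (star_ne_zero.2 (h0 j))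
    · have e : (vecPoly fun m => star (z j m.rev)) = vecPoly (conjRev (z j)) := rfl
      rw [e, hsel, hs, ← mul_assoc, ← Polynomial.C_mul, div_mul_cancel₀ _ (star_ne_zero.2 (h0 j))]
      simp [selPoly]

lemma exists_exchange {N d α : ℕ} (hα : 1 ≤ α) (hd : α < d) (hN : 3 * α ≤ N)
    {l : Fin 3 → ℕ} (hld : ∀ j, l j ≤ d) (hk : ∃ j, l j ≠ d) :
    ∃ Q : ConjPoly d, NonzeroOnImage N d α Q ∧ VanishesOnExchange d α l Q := by
  by_cases hl : ∃ j, l j ≠ 0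
  · exact exists_exchange_mixed hα hd (by omega) hld hk hl
  · push Not at hl
    obtain rfl : l = fun _ => 0 := funext hl
    exact exists_exchange_full hα hd hN

/-! ### Phases and conclusion -/

/-- A polynomial that is nonzero only where no coordinate vanishes. -/
lemma exists_coordinates_ne_zero {N d α : ℕ} :
    ∃ Q : ConjPoly d, NonzeroOnImage N d α Q ∧ ∀ z : Fin 3 → Fin (d + 1) → ℂ,
      evalPair Q z (fun j n => star (z j n)) ≠ 0 → ∀ j n, z j n ≠ 0 := by
  refine ⟨∏ a, MvPolynomial.X (Sum.inl a), ⟨(fun _ => 1, fun _ => 1), (fun _ => 1, fun _ => 1), ?_⟩,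
    fun z hz j n h => hz ?_⟩
  · simp [evalPair, tripleMap_apply]
  · rw [evalPair, map_prod]
    exact Finset.prod_eq_zero (Finset.mem_univ (j, n)) (by simp [h])

lemma exists_angles {c : Fin 3 → ℂ} (hc : ∀ j, ‖c j‖ = 1) (h : c 0 ^ 2 = c 2 * c 1) :
    ∃ θ₀ θα : ℝ, c 0 = Complex.exp (Complex.I * (θ₀ : ℂ)) ∧
      c 1 = Complex.exp (Complex.I * ((θ₀ + θα : ℝ) : ℂ)) ∧
      c 2 = Complex.exp (Complex.I * ((θ₀ - θα : ℝ) : ℂ)) := by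
  obtain ⟨t, e⟩ : ∃ t : Fin 3 → ℝ, ∀ j, c j = Complex.exp (Complex.I * (t j : ℂ)) := by
    refine ⟨fun j => (c j).arg, fun j => ?_⟩
    conv_lhs => rw [← Complex.norm_mul_exp_arg_mul_I (c j), hc j]
    rw [Complex.ofReal_one, one_mul, mul_comm]
  refine ⟨t 0, t 1 - t 0, e 0, ?_, ?_⟩
  · rw [add_sub_cancel]; exact e 1
  · have h1 : c 1 ≠ 0 := fun h0 => by simpa [h0] using hc 1
    refine mul_right_cancel₀ h1 ?_
    rw [← h, e 0, e 1, ← Complex.exp_nat_mul, ← Complex.exp_add]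
    congr 1
    push_cast
    ring

/-- Keeping all `d` roots leaves only the scalar free; the constant coefficient of the product with
the conjugate reversal fixes its modulus. -/
lemma eq_smul_of_vecPoly {d k : ℕ} {y y' : Fin (d + 1) → ℂ} (h0 : y 0 ≠ 0)
    (hd : y (Fin.last d) ≠ 0) (h : fourierIntensity y' = fourierIntensity y) {l : ℕ} (hl : l ≤ d)
    (hk : k ≤ d) (hlk : l + k = d) (hld : l = d) {r s : Fin d → ℂ} {c : ℂ}
    (hr : vecPoly y = Polynomial.C (y (Fin.last d)) * ∏ i, (Polynomial.X - Polynomial.C (r i)))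
    (hs : vecPoly y' = Polynomial.C c * selPoly hl hk r s) :
    ∃ a : ℂ, ‖a‖ = 1 ∧ y' = a • y := by
  subst hld
  obtain rfl : k = 0 := by omega
  have e : y' = (c / y (Fin.last l)) • y := by
    funext n
    have h1 := coeff_vecPoly_fin y n
    have h2 := coeff_vecPoly_fin y' n
    rw [hr, Polynomial.coeff_C_mul] at h1
    rw [hs, Polynomial.coeff_C_mul] at h2
    rw [Pi.smul_apply, smul_eq_mul, ← h1, ← h2]
    simp only [selPoly, Fin.castLE_rfl, id_eq, Finset.univ_eq_empty, Finset.prod_empty, mul_one]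
    field_simp
  refine ⟨_, ?_, e⟩
  have h1 := congrArg (fun p => p.coeff 0) (vecPoly_mul_conjRev_eq h)
  have h3 : ∀ v : Fin (l + 1) → ℂ, (vecPoly v).coeff 0 = v 0 := fun v => coeff_vecPoly_fin v 0
  simp only [Polynomial.mul_coeff_zero, h3] at h1
  rw [e] at h1
  generalize c / y (Fin.last l) = a at h1
  simp only [conjRev, Pi.smul_apply, smul_eq_mul, star_mul', Fin.rev_zero] at h1
  have h4 : a * star a = 1 := by
    have h5 : y 0 * star (y (Fin.last l)) ≠ 0 := mul_ne_zero h0 (star_ne_zero.2 hd)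
    refine mul_right_cancel₀ h5 ?_
    linear_combination h1
  rw [Complex.star_def, Complex.mul_conj'] at h4
  have h5 : ‖a‖ ^ 2 = 1 := by exact_mod_cast h4
  exact (pow_eq_one_iff_of_nonneg (norm_nonneg _) two_ne_zero).1 h5

end BlindSTFT

theorem mainTheorem4 (N W L : ℕ) (hWN : W ≤ N)
    (hR : 3 ≤ N / Nat.gcd L N) (hW : Nat.gcd L N + 2 ≤ W) :
    BlindSTFT.HoldsGenerically (BlindSTFT.tripleVariety N W (Nat.gcd L N))
      (fun z => ∀ z' ∈ BlindSTFT.tripleVariety N W (Nat.gcd L N),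
        (∀ j : Fin 3, BlindSTFT.fourierIntensity (z' j) = BlindSTFT.fourierIntensity (z j)) →
        ∃ θ₀ θα : ℝ,
          z' 0 = Complex.exp (Complex.I * (θ₀ : ℂ)) • z 0 ∧
          z' 1 = Complex.exp (Complex.I * ((θ₀ + θα : ℝ) : ℂ)) • z 1 ∧
          z' 2 = Complex.exp (Complex.I * ((θ₀ - θα : ℝ) : ℂ)) • z 2) := by
  have hα : 1 ≤ Nat.gcd L N := Nat.gcd_pos_of_pos_right _ (by omega)
  have hN : 3 * Nat.gcd L N ≤ N := (Nat.le_div_iff_mul_le (by omega)).1 hR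
  generalize Nat.gcd L N = α at *
  obtain ⟨d, rfl⟩ : ∃ d, W = d + 1 := ⟨W - 1, by omega⟩
  have hd : α < d := by omega
  have hex : ∀ l : Fin 3 → Fin (d + 1), ∃ Q : BlindSTFT.ConjPoly d,
      BlindSTFT.NonzeroOnImage N d α Q ∧ ((∃ j, (l j : ℕ) ≠ d) →
        BlindSTFT.VanishesOnExchange d α (fun j => l j) Q) := by
    intro l
    by_cases hl : ∃ j, (l j : ℕ) ≠ d
    · obtain ⟨Q, h1, h2⟩ := BlindSTFT.exists_exchange hα hd hN
        (l := fun j => l j) (fun j => by have := (l j).2; omega) hl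
      exact ⟨Q, h1, fun _ => h2⟩
    -- The trivial type, where all roots are kept, must not be excluded, so it receives the harmless
    -- polynomial `1`.
    · exact ⟨1, ⟨0, 0, by simp [BlindSTFT.evalPair]⟩, fun h => absurd h hl⟩
  choose Q hQ hQv using hex
  obtain ⟨Q₀, hQ₀, hz₀⟩ := BlindSTFT.exists_coordinates_ne_zero (N := N) (d := d) (α := α)
  obtain ⟨q, hq, hqz⟩ := BlindSTFT.exists_generic (N := N) (α := α) Finset.univ
    -- `none` carries the condition that no coordinate vanishes, `some l` the exclusion of type `l`.
    (fun o : Option (Fin 3 → Fin (d + 1)) => o.elim Q₀ Q) (by rintro (_ | l) _; exacts [hQ₀, hQ l])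
  refine ⟨q, hq, fun z hz hqn z' hz' hint => ?_⟩
  have hne := hz₀ z (hqz z hqn none (Finset.mem_univ _))
  choose l k hl hk r s c hlk hc hr hs hsel using fun j =>
    BlindSTFT.exists_root_selection (hint j) (hne j 0) (hne j (Fin.last d))
  have hld : ∀ j, l j = d := by
    by_contra! h
    refine hqz z hqn (some fun j => ⟨l j, by have := hl j; omega⟩) (Finset.mem_univ _) ?_
    exact hQv _ h z z' (fun j => hne j 0) (fun j => hne j _)
      (BlindSTFT.binomialRelations_of_mem hz') fun j =>
        ⟨k j, hl j, hk j, r j, s j, c j, hlk j, hc j, hr j, hs j, hsel j⟩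
  choose a ha hza using fun j => BlindSTFT.eq_smul_of_vecPoly (hne j 0) (hne j _) (hint j) (hl j)
    (hk j) (hlk j) (hld j) (hr j) (hsel j)
  have h1 := BlindSTFT.binomialRelations_of_mem hz 0 ⟨α, by omega⟩ rfl
  have h2 := BlindSTFT.binomialRelations_of_mem hz' 0 ⟨α, by omega⟩ rfl
  rw [hza 0, hza 1, hza 2] at h2
  simp only [Pi.smul_apply, smul_eq_mul] at h2
  have h3 : a 0 ^ 2 = a 2 * a 1 := by
    refine mul_right_cancel₀ (mul_ne_zero (hne 0 0) (hne 0 ⟨α, by omega⟩)) ?_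
    linear_combination h2 - a 2 * a 1 * h1
  obtain ⟨θ₀, θα, e0, e1, e2⟩ := BlindSTFT.exists_angles ha h3
  exact ⟨θ₀, θα, by rw [← e0]; exact hza 0, by rw [← e1]; exact hza 1, by rw [← e2]; exact hza 2⟩
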